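/- Throughout, $\log$ is the natural logarithm, $\log_2(x)=\log\log x$ and $\log_3(x)=\log\log\log x$ (iterated logarithms, not logarithms to base $2$ or $3$). Let $G$ be an abelian group. For a finitely supported $G$-valued random variable $X$ with $p_X(x)=\mathbb{P}(X=x)$, let $\mathbb{H}(X)=\sum_{x\in G}p_X(x)\log(1/p_X(x))$ be its Shannon entropy (terms with $p_X(x)=0$ being $0$), let $nX$ denote the sum of $n$ i.i.d. copies of $X$, and for finitely supported $X,Y$ let $$d[X;Y]=\mathbb{H}(X'-Y')-\tfrac12\mathbb{H}(X)-\tfrac12\mathbb{H}(Y)$$ be the entropic Ruzsa distance, where $X',Y'$ are independent copies of $X,Y$. Let $A\subset G$ be a nonempty finite set and $K$ a real number with $|A+A|\le K|A|$, let $U_A$ be uniformly distributed on $A$, let $\eta=1/1009$, and for random variables $X,Y$ supported on $A$ define $$\tau[X;Y]=d[X;Y]+\frac{\eta}{\log_2(16K)\log_3(16K)}\bigl(d[X;U_A]+d[Y;U_A]\bigr).$$ **Proposition 3.1.** There is an absolute constant $C$ (independent of $G,A,K,X,Y$) such that the following holds. Let $(X,Y)$ be a minimizer of $\tau$, i.e.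 $X,Y$ are supported on $A$ and $\tau[X;Y]\le\tau[X';Y']$ for all random variables $X',Y'$ supported on $A$, and write $\log k=d[X;Y]$. Then either $K\le C$, or $$d[nX;nY]\le\log k+\log k\cdot\log_2(16n)\qquad\text{for all integers } 2\le n\le(\log K)^6 .$$ -/

import Mathlib

open scoped Pointwise

noncomputable section

namespace EntropicRuzsa

/-- The iterated logarithm `log₂ x = log log x` (not the logarithm to base `2`). -/
def log₂ (x : ℝ) : ℝ := Real.log (Real.log x)

/-- The iterated logarithm `log₃ x = log log log x` (not the logarithm to base `3`). -/
def log₃ (x : ℝ) : ℝ := Real.log (Real.log (Real.log x))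

/-- Shannon entropy `ℍ(X) = ∑ₓ p(x) log (1 / p(x))` of a discrete random variable `X` with law `p`.
The summand is zero where `p x = 0`, since `0 * log (1 / 0) = 0` in Lean. -/
def entropy {G : Type*} (p : PMF G) : ℝ :=
  ∑' x, (p x).toReal * Real.log (1 / (p x).toReal)

/-- The law of `X' - Y'`, where `X'` and `Y'` are independent with laws `p` and `q`. -/
def subLaw {G : Type*} [AddCommGroup G] (p q : PMF G) : PMF G :=
  p.bind fun x => q.bind fun y => PMF.pure (x - y)

/-- The law of `nX`, the sum of `n` independent copies of a random variable with law `p`: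
draw the sum of the first `n` copies, then independently one more copy, and add. -/
def iidSum {G : Type*} [AddCommGroup G] (p : PMF G) : ℕ → PMF G
  | 0 => PMF.pure 0
  | n + 1 => (iidSum p n).bind fun s => p.bind fun x => PMF.pure (s + x)

/-- The entropic Ruzsa distance `d[X;Y] = ℍ(X' - Y') - ℍ(X)/2 - ℍ(Y)/2`, with `X'` and `Y'`
independent copies of `X` and `Y`. -/
def ruzsaDist {G : Type*} [AddCommGroup G] (p q : PMF G) : ℝ :=
  entropy (subLaw p q) - 1 / 2 * entropy p - 1 / 2 * entropy q

/-- The constant `η = 1/1009`. -/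
def η : ℝ := 1 / 1009

/-- The functional
`τ[X;Y] = d[X;Y] + η / (log₂(16K) log₃(16K)) * (d[X;U_A] + d[Y;U_A])`,
with `U_A` uniformly distributed on the nonempty finite set `A`. -/
def τ {G : Type*} [AddCommGroup G] (A : Finset G) (hA : A.Nonempty) (K : ℝ) (p q : PMF G) : ℝ :=
  ruzsaDist p q + η / (log₂ (16 * K) * log₃ (16 * K)) *
    (ruzsaDist p (PMF.uniformOfFinset A hA) + ruzsaDist q (PMF.uniformOfFinset A hA))

/-- `(X, Y)`, with laws `p` and `q`, minimizes `τ` among all pairs of random variables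
supported on `A`. -/
structure IsMinimizer {G : Type*} [AddCommGroup G] (A : Finset G) (hA : A.Nonempty) (K : ℝ)
    (p q : PMF G) : Prop where
  support_left : p.support ⊆ A
  support_right : q.support ⊆ A
  le : ∀ p' q' : PMF G, p'.support ⊆ A → q'.support ⊆ A → τ A hA K p q ≤ τ A hA K p' q'

end EntropicRuzsa

end

/-! The bound proved is stronger: `d[nX;nY] ≤ 2 d[X;Y]`, and `log₂ (16n) ≥ 1` for `n ≥ 2`. Write `δ`
for the coefficient in `τ`. Fibring along `(S+X, T+Y)` bounds `d[S+X;T+Y]` by `d[S;T] + d[X;Y]`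
minus the average distance between `X` and `Y` conditioned on those sums. Conditioned variables
still live on `A`, so minimality makes that average at least `d[X;Y]`, up to `δ` times the rise in
distance to `U_A`, which is at most half the entropy increments (`IsMinimizer.ruzsaDist_addLaw_le`).
Telescoping gives `d[nX;nY] ≤ d[X;Y] + (δ/2)(ℍ(nX) - ℍ(X) + ℍ(nY) - ℍ(Y))`. The entropy growth is
controlled by doubling: `ℍ(2Z) ≤ ℍ(Z) + 2 d[Z;W]`. If distances at the powers of two below `n` are
at most `2 d[X;Y]`, each increment is at most `4 ⌈log n / log 2⌉ d[X;Y]`, so strong induction closes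
once `4 δ ⌈log n / log 2⌉ ≤ 1`. For `n ≤ (log K)^6` the ceiling is `O(log log K)`, and `δ` is small
enough. -/

noncomputable section

namespace EntropicRuzsa

variable {α β γ Ω G : Type*}

/-! ### Averages over finitely supported laws -/

/-- The expectation of `f` under the law `p`. -/
def avg (p : PMF α) (f : α → ℝ) : ℝ := ∑' x, (p x).toReal * f x

/-- The joint law of `(a, b)`, where `a` has law `q` and `b` has law `κ a` given `a`. -/
def joint (q : PMF α) (κ : α → PMF β) : PMF (α × β) :=
  q.bind fun a => (κ a).bind fun b => PMF.pure (a, b)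

/-- The law of `X' + Y'` with `X'`, `Y'` independent of laws `p`, `q`. -/
def addLaw [AddCommGroup G] (p q : PMF G) : PMF G :=
  p.bind fun x => q.bind fun y => PMF.pure (x + y)

lemma avg_eq_sum (p : PMF α) (f : α → ℝ) {s : Finset α} (hs : p.support ⊆ s) :
    avg p f = ∑ x ∈ s, (p x).toReal * f x := by
  refine tsum_eq_sum fun x hx => ?_
  have : p x = 0 := by
    by_contra h
    exact hx (hs ((p.mem_support_iff x).2 h))
  simp [this]

lemma sum_toReal_eq_one (p : PMF α) {s : Finset α} (hs : p.support ⊆ s) :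
    ∑ x ∈ s, (p x).toReal = 1 := by
  have h := p.tsum_coe
  rw [tsum_eq_sum (s := s)] at h
  · rw [← ENNReal.toReal_sum fun x _ => p.apply_ne_top x, h, ENNReal.toReal_one]
  · intro x hx
    by_contra h'
    exact hx (hs ((p.mem_support_iff x).2 h'))

lemma toReal_pos {p : PMF α} {x : α} (hx : x ∈ p.support) : 0 < (p x).toReal :=
  ENNReal.toReal_pos ((p.mem_support_iff x).1 hx) (p.apply_ne_top x)

lemma avg_congr {p : PMF α} {f g : α → ℝ} (h : ∀ x ∈ p.support, f x = g x) :
    avg p f = avg p g := by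
  refine tsum_congr fun x => ?_
  by_cases hx : p x = 0
  · simp [hx]
  · rw [h x ((p.mem_support_iff x).2 hx)]

lemma avg_mono {p : PMF α} (hp : p.support.Finite) {f g : α → ℝ}
    (h : ∀ x ∈ p.support, f x ≤ g x) : avg p f ≤ avg p g := by
  rw [avg_eq_sum p f (s := hp.toFinset) (by simp), avg_eq_sum p g (s := hp.toFinset) (by simp)]
  refine Finset.sum_le_sum fun x hx => ?_
  exact mul_le_mul_of_nonneg_left (h x (by simpa using hx)) ENNReal.toReal_nonneg

lemma avg_add {p : PMF α} (hp : p.support.Finite) (f g : α → ℝ) :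
    avg p (fun x => f x + g x) = avg p f + avg p g := by
  simp only [avg_eq_sum p _ (s := hp.toFinset) (by simp), mul_add, Finset.sum_add_distrib]

lemma avg_const_mul (p : PMF α) (c : ℝ) (f : α → ℝ) :
    avg p (fun x => c * f x) = c * avg p f := by
  simp only [avg, ← tsum_mul_left]
  exact tsum_congr fun x => by ring

lemma avg_const {p : PMF α} (hp : p.support.Finite) (c : ℝ) : avg p (fun _ => c) = c := by
  rw [avg_eq_sum p _ (s := hp.toFinset) (by simp), ← Finset.sum_mul,
    sum_toReal_eq_one p (by simp), one_mul]

lemma avg_pure (a : α) (f : α → ℝ) : avg (PMF.pure a) f = f a := by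
  rw [avg_eq_sum _ f (s := {a}) (by simp)]
  simp

lemma finite_support_bind {q : PMF α} (hq : q.support.Finite) {κ : α → PMF β}
    (hκ : ∀ a, (κ a).support.Finite) : (q.bind κ).support.Finite := by
  rw [PMF.support_bind]
  exact hq.biUnion fun a _ => hκ a

lemma finite_support_pure (a : α) : (PMF.pure a).support.Finite := by
  rw [PMF.support_pure]
  exact Set.finite_singleton a

lemma finite_support_map {p : PMF α} (hp : p.support.Finite) (f : α → β) :
    (p.map f).support.Finite := by
  rw [PMF.support_map]
  exact hp.image f

lemma bind_toReal {q : PMF α} {κ : α → PMF β} {s : Finset α} (hs : q.support ⊆ s) (b : β) :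
    (q.bind κ b).toReal = ∑ a ∈ s, (q a).toReal * (κ a b).toReal := by
  rw [PMF.bind_apply, tsum_eq_sum (s := s), ENNReal.toReal_sum]
  · simp
  · exact fun a _ => ENNReal.mul_ne_top (q.apply_ne_top a) ((κ a).apply_ne_top b)
  · intro a ha
    have : q a = 0 := by
      by_contra h'
      exact ha (hs ((q.mem_support_iff a).2 h'))
    simp [this]

lemma avg_bind {q : PMF α} (hq : q.support.Finite) {κ : α → PMF β}
    (hκ : ∀ a, (κ a).support.Finite) (f : β → ℝ) :
    avg (q.bind κ) f = avg q fun a => avg (κ a) f := by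
  classical
  have hs : q.support ⊆ hq.toFinset := by simp
  set t : Finset β := hq.toFinset.biUnion fun a => (hκ a).toFinset with ht
  have h1 : (q.bind κ).support ⊆ t := by
    intro b hb
    simp only [PMF.support_bind, Set.mem_iUnion, exists_prop] at hb
    obtain ⟨a, ha, hb⟩ := hb
    simp only [ht, Finset.coe_biUnion, Set.mem_iUnion, Finset.mem_coe, Set.Finite.mem_toFinset,
      exists_prop]
    exact ⟨a, ha, hb⟩
  rw [avg_eq_sum _ _ h1, avg_eq_sum _ _ hs]
  have h2 : ∀ a ∈ hq.toFinset, avg (κ a) f = ∑ b ∈ t, (κ a b).toReal * f b := by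
    intro a ha
    refine avg_eq_sum _ _ fun b hb => ?_
    simp only [ht, Finset.coe_biUnion, Set.mem_iUnion, Finset.mem_coe, Set.Finite.mem_toFinset,
      exists_prop]
    exact ⟨a, by simpa using ha, hb⟩
  rw [Finset.sum_congr rfl fun a ha => congrArg ((q a).toReal * ·) (h2 a ha)]
  simp only [bind_toReal hs, Finset.sum_mul, Finset.mul_sum]
  rw [Finset.sum_comm]
  exact Finset.sum_congr rfl fun a _ => Finset.sum_congr rfl fun b _ => by ring

lemma avg_map {p : PMF α} (hp : p.support.Finite) (f : α → β) (g : β → ℝ) :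
    avg (p.map f) g = avg p fun a => g (f a) := by
  have : p.map f = p.bind fun a => PMF.pure (f a) := rfl
  rw [this, avg_bind hp (fun a => finite_support_pure _)]
  simp only [avg_pure]

/-! ### Shannon entropy: chain rule, subadditivity, submodularity -/

lemma entropy_eq_avg (p : PMF α) : entropy p = avg p fun x => Real.log (1 / (p x).toReal) := rfl

lemma map_apply_of_injective (p : PMF α) {f : α → β} (hf : f.Injective) (a : α) :
    p.map f (f a) = p a := by
  classical
  rw [PMF.map_apply, tsum_eq_single a]
  · simp
  · intro b hb
    rw [if_neg fun h => hb (hf h).symm]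

lemma entropy_map_of_injective {p : PMF α} (hp : p.support.Finite) {f : α → β}
    (hf : f.Injective) : entropy (p.map f) = entropy p := by
  rw [entropy_eq_avg, entropy_eq_avg, avg_map hp]
  simp only [map_apply_of_injective p hf]

lemma joint_apply (q : PMF α) (κ : α → PMF β) (a : α) (b : β) :
    joint q κ (a, b) = q a * κ a b := by
  classical
  rw [joint, PMF.bind_apply, tsum_eq_single a]
  · congr 1
    exact map_apply_of_injective (κ a) (Prod.mk_right_injective a) b
  · intro a' ha'
    rw [PMF.bind_apply, ENNReal.tsum_eq_zero.2, mul_zero]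
    intro b'
    rw [PMF.pure_apply, if_neg, mul_zero]
    intro h
    exact ha' (congrArg Prod.fst h).symm

lemma finite_support_joint {q : PMF α} (hq : q.support.Finite) {κ : α → PMF β}
    (hκ : ∀ a, (κ a).support.Finite) : (joint q κ).support.Finite :=
  finite_support_bind hq fun a => finite_support_bind (hκ a) fun _ => finite_support_pure _

lemma map_fst_joint (q : PMF α) (κ : α → PMF β) : (joint q κ).map Prod.fst = q := by
  simp only [joint, PMF.map_bind, PMF.pure_map, PMF.bind_const, PMF.bind_pure]

lemma map_snd_joint (q : PMF α) (κ : α → PMF β) : (joint q κ).map Prod.snd = q.bind κ := by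
  simp only [joint, PMF.map_bind, PMF.pure_map, PMF.bind_pure]

/-- The chain rule for entropy. -/
lemma entropy_joint {q : PMF α} (hq : q.support.Finite) {κ : α → PMF β}
    (hκ : ∀ a, (κ a).support.Finite) :
    entropy (joint q κ) = entropy q + avg q fun a => entropy (κ a) := by
  rw [entropy_eq_avg, joint, avg_bind hq fun a => finite_support_bind (hκ a) fun _ =>
    finite_support_pure _, entropy_eq_avg q, ← avg_add hq]
  refine avg_congr fun a ha => ?_
  rw [avg_bind (hκ a) fun _ => finite_support_pure _, entropy_eq_avg,
    ← avg_const (hκ a) (Real.log (1 / (q a).toReal)), ← avg_add (hκ a)]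
  refine avg_congr fun b hb => ?_
  rw [avg_pure, ← joint, joint_apply, ENNReal.toReal_mul, ← one_div_mul_one_div,
    Real.log_mul (one_div_ne_zero (toReal_pos ha).ne') (one_div_ne_zero (toReal_pos hb).ne')]

/-- Every law on a product is disintegrated along its first marginal. -/
lemma exists_joint_eq (p : PMF (α × β)) :
    ∃ κ : α → PMF β, p = joint (p.map Prod.fst) κ ∧
      ∀ a, (κ a).support ⊆ (p.map Prod.snd).support := by
  classical
  have hq : ∀ a, p.map Prod.fst a = ∑' b, p (a, b) := by
    intro a
    rw [PMF.map_apply, ENNReal.tsum_prod', tsum_eq_single a]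
    · simp
    · intro a' ha'
      simp [ha'.symm]
  let κ : α → PMF β := fun a =>
    if h : (∑' b, p (a, b)) ≠ 0 then
      PMF.normalize (fun b => p (a, b)) h (by rw [← hq]; exact PMF.apply_ne_top _ _)
    -- This default on null fibres keeps every `κ a` supported in the second marginal, so minimality
    -- can later be applied for all values of the condition.
    else p.map Prod.snd
  have hκ : ∀ a, p.map Prod.fst a ≠ 0 → ∀ b, κ a b = p (a, b) * (p.map Prod.fst a)⁻¹ := by
    intro a ha b
    have h : (∑' b, p (a, b)) ≠ 0 := by rwa [← hq]
    simp only [κ]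
    rw [dif_pos h, PMF.normalize_apply, hq]
  refine ⟨κ, ?_, ?_⟩
  · ext ⟨a, b⟩
    rw [joint_apply]
    by_cases ha : p.map Prod.fst a = 0
    · have := ha
      rw [hq, ENNReal.tsum_eq_zero] at this
      rw [ha, this b, zero_mul]
    · rw [hκ a ha, mul_comm (p (a, b)), ← mul_assoc,
        ENNReal.mul_inv_cancel ha (PMF.apply_ne_top _ _), one_mul]
  · intro a b hb
    by_cases ha : p.map Prod.fst a = 0
    · have h : ¬ (∑' b, p (a, b)) ≠ 0 := by rw [← hq, not_not]; exact ha
      simp only [κ] at hb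
      rwa [dif_neg h] at hb
    · rw [PMF.mem_support_iff, hκ a ha] at hb
      rw [PMF.support_map]
      exact ⟨(a, b), (p.mem_support_iff _).2 (left_ne_zero_of_mul hb), rfl⟩

/-- Gibbs' inequality. -/
lemma entropy_le_avg_log {p : PMF α} (hp : p.support.Finite) {r : α → ℝ}
    (hr : ∀ x ∈ p.support, 0 < r x) (hsum : ∑ x ∈ hp.toFinset, r x ≤ 1) :
    entropy p ≤ avg p fun x => Real.log (1 / r x) := by
  have hs : p.support ⊆ hp.toFinset := by simp
  rw [entropy_eq_avg, avg_eq_sum p _ hs, avg_eq_sum p _ hs]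
  -- This is `log t ≤ t - 1` at `t = r x / p x`, multiplied by `p x`.
  have key : ∀ x ∈ hp.toFinset, (p x).toReal * Real.log (1 / (p x).toReal) ≤
      (p x).toReal * Real.log (1 / r x) + (r x - (p x).toReal) := by
    intro x hx
    have hx' : x ∈ p.support := by simpa using hx
    have h0 := toReal_pos hx'
    have h1 := hr x hx'
    have h2 := Real.log_le_sub_one_of_pos (div_pos h1 h0)
    rw [Real.log_div h1.ne' h0.ne'] at h2
    rw [one_div, one_div, Real.log_inv, Real.log_inv]
    have h3 := mul_le_mul_of_nonneg_left h2 h0.le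
    have h4 : (p x).toReal * (r x / (p x).toReal - 1) = r x - (p x).toReal := by
      field_simp
    nlinarith
  refine (Finset.sum_le_sum key).trans ?_
  rw [Finset.sum_add_distrib, Finset.sum_sub_distrib, sum_toReal_eq_one p hs]
  linarith

/-- Gibbs' inequality against the product of the two marginals. -/
lemma entropy_le_add {p : PMF (α × β)} (hp : p.support.Finite) :
    entropy p ≤ entropy (p.map Prod.fst) + entropy (p.map Prod.snd) := by
  classical
  have h1 := finite_support_map hp Prod.fst
  have h2 := finite_support_map hp Prod.snd
  have m1 : ∀ x ∈ p.support, x.1 ∈ (p.map Prod.fst).support := by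
    intro x hx; rw [PMF.support_map]; exact ⟨x, hx, rfl⟩
  have m2 : ∀ x ∈ p.support, x.2 ∈ (p.map Prod.snd).support := by
    intro x hx; rw [PMF.support_map]; exact ⟨x, hx, rfl⟩
  refine (entropy_le_avg_log hp
    (r := fun x => (p.map Prod.fst x.1).toReal * (p.map Prod.snd x.2).toReal)
    (fun x hx => mul_pos (toReal_pos (m1 x hx)) (toReal_pos (m2 x hx))) ?_).trans_eq ?_
  · have hsub : hp.toFinset ⊆ h1.toFinset ×ˢ h2.toFinset := by
      intro x hx
      have hx' : x ∈ p.support := by simpa using hx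
      exact Finset.mem_product.2 ⟨h1.mem_toFinset.2 (m1 x hx'), h2.mem_toFinset.2 (m2 x hx')⟩
    refine (Finset.sum_le_sum_of_subset_of_nonneg hsub fun _ _ _ => by positivity).trans_eq ?_
    rw [Finset.sum_product]
    simp only [← Finset.mul_sum]
    rw [sum_toReal_eq_one (p.map Prod.snd) (by simp)]
    simp only [mul_one]
    exact sum_toReal_eq_one (p.map Prod.fst) (by simp)
  · rw [entropy_eq_avg (p.map Prod.fst), entropy_eq_avg (p.map Prod.snd), avg_map hp, avg_map hp,
      ← avg_add hp]
    refine avg_congr fun x hx => ?_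
    have := toReal_pos (m1 x hx)
    have := toReal_pos (m2 x hx)
    rw [← Real.log_mul (by positivity) (by positivity)]
    congr 1
    field_simp

/-- Conditioning does not increase entropy. -/
lemma avg_entropy_le {q : PMF α} (hq : q.support.Finite) {κ : α → PMF β}
    (hκ : ∀ a, (κ a).support.Finite) : avg q (fun a => entropy (κ a)) ≤ entropy (q.bind κ) := by
  have h := entropy_le_add (finite_support_joint hq hκ)
  rw [map_fst_joint, map_snd_joint, entropy_joint hq hκ] at h
  linarith

lemma map_joint_snd (q : PMF α) (κ : α → PMF β) (f : β → γ) :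
    (joint q κ).map (fun x => (x.1, f x.2)) = joint q fun a => (κ a).map f := by
  simp only [joint, PMF.map_bind, PMF.pure_map, PMF.bind_map, Function.comp_def]

/-- Submodularity of entropy. -/
lemma entropy_submodular {p : PMF Ω} (hp : p.support.Finite) (f : Ω → α) (g : Ω → β) (h : Ω → γ) :
    entropy (p.map fun ω => (h ω, f ω, g ω)) + entropy (p.map h) ≤
      entropy (p.map fun ω => (h ω, f ω)) + entropy (p.map fun ω => (h ω, g ω)) := by
  -- Conditioned on `h`, the claim is subadditivity for `(f, g)`; the chain rule then averages it.
  obtain ⟨κ, hκ, hsupp⟩ := exists_joint_eq (p.map fun ω => (h ω, f ω, g ω))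
  have hfin : ∀ a, (κ a).support.Finite := fun a =>
    (finite_support_map (finite_support_map hp _) _).subset (hsupp a)
  rw [PMF.map_comp] at hκ
  have hq := finite_support_map hp h
  have e1 : p.map (fun ω => (h ω, f ω)) = joint (p.map h) fun a => (κ a).map Prod.fst := by
    rw [← map_joint_snd]
    refine Eq.trans ?_ (congrArg (PMF.map fun x : γ × α × β => (x.1, x.2.1)) hκ)
    rw [PMF.map_comp]
    rfl
  have e2 : p.map (fun ω => (h ω, g ω)) = joint (p.map h) fun a => (κ a).map Prod.snd := by
    rw [← map_joint_snd]
    refine Eq.trans ?_ (congrArg (PMF.map fun x : γ × α × β => (x.1, x.2.2)) hκ)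
    rw [PMF.map_comp]
    rfl
  have e0 : p.map (fun ω => (h ω, f ω, g ω)) = joint (p.map h) κ := hκ
  rw [e0, e1, e2, entropy_joint hq hfin,
    entropy_joint hq fun a => finite_support_map (hfin a) _,
    entropy_joint hq fun a => finite_support_map (hfin a) _]
  have := avg_mono hq fun a _ => entropy_le_add (hfin a)
  rw [avg_add hq] at this
  linarith

lemma entropy_prod {p : PMF α} {q : PMF β} (hp : p.support.Finite) (hq : q.support.Finite) :
    entropy (joint p fun _ => q) = entropy p + entropy q := by
  rw [entropy_joint hp fun _ => hq, avg_const hp]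

/-! ### Sums and differences of independent variables -/

section Group

variable [AddCommGroup G] {p q r S T X Y U : PMF G}

lemma finite_support_addLaw (hp : p.support.Finite) (hq : q.support.Finite) :
    (addLaw p q).support.Finite :=
  finite_support_bind hp fun _ => finite_support_bind hq fun _ => finite_support_pure _

lemma finite_support_subLaw (hp : p.support.Finite) (hq : q.support.Finite) :
    (subLaw p q).support.Finite :=
  finite_support_bind hp fun _ => finite_support_bind hq fun _ => finite_support_pure _

lemma finite_support_iidSum (hp : p.support.Finite) : ∀ n, (iidSum p n).support.Finite
  | 0 => finite_support_pure _
  | n + 1 => finite_support_addLaw (finite_support_iidSum hp n) hp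

lemma addLaw_assoc (p q r : PMF G) : addLaw (addLaw p q) r = addLaw p (addLaw q r) := by
  simp only [addLaw, PMF.bind_bind, PMF.pure_bind, add_assoc]

lemma iidSum_one (p : PMF G) : iidSum p 1 = p := by
  simp only [iidSum, PMF.pure_bind, zero_add, PMF.bind_pure]

lemma iidSum_add (p : PMF G) (m : ℕ) : ∀ n, iidSum p (m + n) = addLaw (iidSum p m) (iidSum p n)
  | 0 => by simp only [addLaw, iidSum, PMF.pure_bind, add_zero, PMF.bind_pure]
  | n + 1 => by
    change addLaw (iidSum p (m + n)) p = addLaw (iidSum p m) (addLaw (iidSum p n) p)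
    rw [iidSum_add p m n, addLaw_assoc]

/-- The law of `X' - Y'` is that of `X' + (-Y')`. -/
lemma subLaw_eq_addLaw (p q : PMF G) : subLaw p q = addLaw p (q.map Neg.neg) := by
  simp only [subLaw, addLaw, PMF.bind_map, Function.comp_def, sub_eq_add_neg]

lemma entropy_neg (hp : p.support.Finite) : entropy (p.map Neg.neg) = entropy p :=
  entropy_map_of_injective hp neg_injective

lemma addLaw_comm (p q : PMF G) : addLaw p q = addLaw q p := by
  rw [addLaw, PMF.bind_comm]
  simp only [addLaw, add_comm]

/-- The joint law of `(S' + X', X')`. -/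
def sumPair (S X : PMF G) : PMF (G × G) :=
  S.bind fun s => X.bind fun x => PMF.pure (s + x, x)

lemma finite_support_sumPair (hS : S.support.Finite) (hX : X.support.Finite) :
    (sumPair S X).support.Finite :=
  finite_support_bind hS fun _ => finite_support_bind hX fun _ => finite_support_pure _

lemma map_fst_sumPair (S X : PMF G) : (sumPair S X).map Prod.fst = addLaw S X := by
  simp only [sumPair, addLaw, PMF.map_bind, PMF.pure_map]

lemma map_snd_sumPair (S X : PMF G) : (sumPair S X).map Prod.snd = X := by
  simp only [sumPair, PMF.map_bind, PMF.pure_map, PMF.bind_pure, PMF.bind_const]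

lemma entropy_sumPair (hS : S.support.Finite) (hX : X.support.Finite) :
    entropy (sumPair S X) = entropy S + entropy X := by
  rw [← entropy_prod hS hX]
  have : sumPair S X = (joint S fun _ => X).map fun u => (u.1 + u.2, u.2) := by
    simp only [sumPair, joint, PMF.map_bind, PMF.pure_map]
  rw [this]
  refine entropy_map_of_injective (finite_support_joint hS fun _ => hX) ?_
  rintro ⟨a, b⟩ ⟨c, d⟩ h
  simp only [Prod.mk.injEq] at h
  obtain ⟨h1, rfl⟩ := h
  simpa using h1

/-- The pair `(S' + X', X')` determines `(S', X')`, so subadditivity applies and `ℍ(X)` cancels. -/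
lemma entropy_le_entropy_addLaw (hS : S.support.Finite) (hX : X.support.Finite) :
    entropy S ≤ entropy (addLaw S X) := by
  have h := entropy_le_add (finite_support_sumPair hS hX)
  rw [map_fst_sumPair, map_snd_sumPair, entropy_sumPair hS hX] at h
  linarith

lemma entropy_le_entropy_subLaw (hS : S.support.Finite) (hX : X.support.Finite) :
    entropy S ≤ entropy (subLaw S X) := by
  rw [subLaw_eq_addLaw]
  exact entropy_le_entropy_addLaw hS (finite_support_map hX _)

lemma ruzsaDist_nonneg (hX : X.support.Finite) (hY : Y.support.Finite) :
    0 ≤ ruzsaDist X Y := by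
  have h1 := entropy_le_entropy_subLaw hX hY
  have h2 := entropy_le_entropy_addLaw (finite_support_map hY Neg.neg) hX
  rw [entropy_neg hY, addLaw_comm, ← subLaw_eq_addLaw] at h2
  rw [ruzsaDist]
  linarith

/-! ### Kaimanovich–Vershik and doubling -/

/-- The Kaimanovich–Vershik inequality. -/
lemma entropy_addLaw_addLaw_le (hp : p.support.Finite) (hq : q.support.Finite)
    (hr : r.support.Finite) :
    entropy (addLaw (addLaw p q) r) + entropy q ≤ entropy (addLaw p q) + entropy (addLaw q r) := by
  set P : PMF (G × G × G) := joint p fun _ => joint q fun _ => r with hP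
  have hPfin : P.support.Finite :=
    finite_support_joint hp fun _ => finite_support_joint hq fun _ => hr
  have h := entropy_submodular hPfin (fun u => u.1) (fun u => u.2.2)
    (fun u => u.1 + u.2.1 + u.2.2)
  have e1 : P.map (fun u => u.1 + u.2.1 + u.2.2) = addLaw (addLaw p q) r := by
    simp only [hP, joint, addLaw, PMF.map_bind, PMF.pure_map, PMF.bind_bind, PMF.pure_bind]
  have e2 : entropy (P.map fun u => (u.1 + u.2.1 + u.2.2, u.1, u.2.2)) =
      entropy p + (entropy q + entropy r) := by
    rw [entropy_map_of_injective hPfin, hP, entropy_prod hp (finite_support_joint hq fun _ => hr),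
      entropy_prod hq hr]
    rintro ⟨a, b, c⟩ ⟨a', b', c'⟩ h
    simp only [Prod.mk.injEq] at h
    obtain ⟨h1, rfl, rfl⟩ := h
    simpa using h1
  have e3 : entropy (P.map fun u => (u.1 + u.2.1 + u.2.2, u.1)) =
      entropy p + entropy (addLaw q r) := by
    rw [← entropy_prod hp (finite_support_addLaw hq hr),
      ← entropy_map_of_injective (f := fun u : G × G => (u.1 + u.2, u.1))
        (finite_support_joint hp fun _ => finite_support_addLaw hq hr)]
    · simp only [hP, joint, addLaw, PMF.map_bind, PMF.pure_map, PMF.bind_bind, PMF.pure_bind,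
        add_assoc]
    · rintro ⟨a, b⟩ ⟨c, d⟩ h
      simp only [Prod.mk.injEq] at h
      obtain ⟨h1, rfl⟩ := h
      simpa using h1
  have e4 : entropy (P.map fun u => (u.1 + u.2.1 + u.2.2, u.2.2)) =
      entropy (addLaw p q) + entropy r := by
    rw [← entropy_sumPair (finite_support_addLaw hp hq) hr]
    simp only [hP, joint, addLaw, sumPair, PMF.map_bind, PMF.pure_map, PMF.bind_bind,
      PMF.pure_bind]
  rw [e1, e2, e3, e4] at h
  linarith

/-- Kaimanovich–Vershik for `X, -Y, X` gives `ℍ(X - Y + X) + ℍ(Y) ≤ 2 ℍ(X - Y)`, and dropping `-Y`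
only lowers the left side. -/
lemma entropy_addLaw_self_le (hX : X.support.Finite) (hY : Y.support.Finite) :
    entropy (addLaw X X) ≤ entropy X + 2 * ruzsaDist X Y := by
  have hY' := finite_support_map hY Neg.neg
  have h := entropy_addLaw_addLaw_le hX hY' hX
  have h2 := entropy_le_entropy_addLaw (finite_support_addLaw hX hX) hY'
  rw [entropy_neg hY, addLaw_comm _ X, ← addLaw_assoc, addLaw_comm (Y.map Neg.neg) X,
    ← subLaw_eq_addLaw, ← subLaw_eq_addLaw] at h
  rw [← subLaw_eq_addLaw] at h2
  rw [ruzsaDist]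
  linarith

lemma ruzsaDist_comm (hX : X.support.Finite) (hY : Y.support.Finite) :
    ruzsaDist X Y = ruzsaDist Y X := by
  have : (subLaw X Y).map Neg.neg = subLaw Y X := by
    rw [subLaw, subLaw, PMF.bind_comm]
    simp only [PMF.map_bind, PMF.pure_map, neg_sub]
  rw [ruzsaDist, ruzsaDist, ← this, entropy_neg (finite_support_subLaw hX hY)]
  ring

/-! ### Conditioning on a sum, and fibring -/

/-- Conditioning `X'` on `S' + X'` raises the distance from `U` by at most half of the entropy
increment `ℍ(S' + X') - ℍ(S')`, on average. -/
lemma avg_ruzsaDist_le (hS : S.support.Finite) (hX : X.support.Finite) (hU : U.support.Finite)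
    {κ : G → PMF G} (hκ : sumPair S X = joint (addLaw S X) κ)
    (hfin : ∀ a, (κ a).support.Finite) :
    avg (addLaw S X) (fun z => ruzsaDist (κ z) U) ≤
      ruzsaDist X U + 1 / 2 * (entropy (addLaw S X) - entropy S) := by
  have hZ := finite_support_addLaw hS hX
  have h1 := entropy_sumPair hS hX
  rw [hκ, entropy_joint hZ hfin] at h1
  have h2 : (addLaw S X).bind κ = X := by rw [← map_snd_joint, ← hκ, map_snd_sumPair]
  have h3 := avg_entropy_le hZ fun z => finite_support_subLaw (hfin z) hU
  have h4 : ((addLaw S X).bind fun z => subLaw (κ z) U) = subLaw X U := by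
    conv_rhs => rw [← h2]
    simp only [subLaw, PMF.bind_bind]
  rw [h4] at h3
  have h5 : avg (addLaw S X) (fun z => ruzsaDist (κ z) U) =
      avg (addLaw S X) (fun z => entropy (subLaw (κ z) U)) +
        (-1 / 2 * avg (addLaw S X) (fun z => entropy (κ z)) + -1 / 2 * entropy U) := by
    rw [← avg_const hZ (-1 / 2 * entropy U), ← avg_const_mul, ← avg_add hZ, ← avg_add hZ]
    exact avg_congr fun z _ => by rw [ruzsaDist]; ring
  rw [h5, ruzsaDist]
  linarith

/-- The fibring inequality for the Ruzsa distance. -/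
lemma ruzsaDist_addLaw_add_avg_le (hS : S.support.Finite) (hX : X.support.Finite)
    (hT : T.support.Finite) (hY : Y.support.Finite) {κ μ : G → PMF G}
    (hκ : sumPair S X = joint (addLaw S X) κ) (hμ : sumPair T Y = joint (addLaw T Y) μ)
    (hκf : ∀ a, (κ a).support.Finite) (hμf : ∀ a, (μ a).support.Finite) :
    ruzsaDist (addLaw S X) (addLaw T Y) +
      avg (addLaw S X) (fun z => avg (addLaw T Y) fun w => ruzsaDist (κ z) (μ w)) ≤
      ruzsaDist S T + ruzsaDist X Y := by
  have hZ := finite_support_addLaw hS hX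
  have hW := finite_support_addLaw hT hY
  have h1 := entropy_sumPair hS hX
  rw [hκ, entropy_joint hZ hκf] at h1
  have h2 := entropy_sumPair hT hY
  rw [hμ, entropy_joint hW hμf] at h2
  set P : PMF (G × G × G × G) := joint S fun _ => joint X fun _ => joint T fun _ => Y with hP
  have hPfin : P.support.Finite := finite_support_joint hS fun _ =>
    finite_support_joint hX fun _ => finite_support_joint hT fun _ => hY
  -- With `Z = S + X` and `W = T + Y`, submodularity over `Z - W` compares `X - Y` with `(Z, W)`.
  -- Given `(Z, W)`, the base is determined and `X - Y` has the conditioned law in `e4`; the pair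
  -- `(Z - W, X - Y)` encodes the independent `S - T`, `X - Y` in `e3`.
  have h := entropy_submodular hPfin (fun u => u.2.1 - u.2.2.2)
    (fun u => (u.1 + u.2.1, u.2.2.1 + u.2.2.2))
    (fun u => (u.1 + u.2.1) - (u.2.2.1 + u.2.2.2))
  have hZW : (joint (addLaw S X) fun _ => addLaw T Y).support.Finite :=
    finite_support_joint hZ fun _ => hW
  have e1 : P.map (fun u => (u.1 + u.2.1) - (u.2.2.1 + u.2.2.2)) =
      subLaw (addLaw S X) (addLaw T Y) := by
    simp only [hP, joint, addLaw, subLaw, PMF.map_bind, PMF.pure_map, PMF.bind_bind,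
      PMF.pure_bind]
  have e2 : entropy (P.map fun u => ((u.1 + u.2.1) - (u.2.2.1 + u.2.2.2),
      (u.1 + u.2.1, u.2.2.1 + u.2.2.2))) = entropy (addLaw S X) + entropy (addLaw T Y) := by
    rw [← entropy_prod hZ hW,
      ← entropy_map_of_injective (f := fun u : G × G => (u.1 - u.2, u)) hZW fun a b h => by
        simpa using (Prod.mk.injEq _ _ _ _ ▸ h).2]
    simp only [hP, joint, addLaw, PMF.map_bind, PMF.pure_map, PMF.bind_bind, PMF.pure_bind]
  have e3 : entropy (P.map fun u => ((u.1 + u.2.1) - (u.2.2.1 + u.2.2.2), u.2.1 - u.2.2.2)) =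
      entropy (subLaw S T) + entropy (subLaw X Y) := by
    rw [← entropy_sumPair (finite_support_subLaw hS hT) (finite_support_subLaw hX hY)]
    simp only [hP, joint, sumPair, subLaw, PMF.map_bind, PMF.pure_map, PMF.bind_bind,
      PMF.pure_bind]
    congr 2
    funext s
    rw [PMF.bind_comm]
    congr 1
    funext t
    congr 1
    funext x
    congr 1
    funext y
    rw [add_sub_add_comm]
  have e4 : entropy (P.map fun u => ((u.1 + u.2.1) - (u.2.2.1 + u.2.2.2), u.2.1 - u.2.2.2,
      (u.1 + u.2.1, u.2.2.1 + u.2.2.2))) = entropy (addLaw S X) + entropy (addLaw T Y) +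
        avg (addLaw S X) (fun z => avg (addLaw T Y) fun w => entropy (subLaw (κ z) (μ w))) := by
    have hJ : ∀ u : G × G, (subLaw (κ u.1) (μ u.2)).support.Finite := fun u =>
      finite_support_subLaw (hκf _) (hμf _)
    have ha : avg (addLaw S X)
          (fun z => avg (addLaw T Y) fun w => entropy (subLaw (κ z) (μ w))) =
        avg (joint (addLaw S X) fun _ => addLaw T Y)
          (fun u => entropy (subLaw (κ u.1) (μ u.2))) := by
      rw [joint, avg_bind hZ fun z => finite_support_bind hW fun _ => finite_support_pure _]
      refine avg_congr fun z _ => ?_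
      rw [avg_bind hW fun _ => finite_support_pure _]
      simp only [avg_pure]
    rw [ha, ← entropy_prod hZ hW, ← entropy_joint hZW hJ,
      ← entropy_map_of_injective (f := fun v : (G × G) × G => (v.1.1 - v.1.2, v.2, v.1))
        (finite_support_joint hZW hJ)]
    · congr 1
      have hl : P.map (fun u => ((u.1 + u.2.1) - (u.2.2.1 + u.2.2.2), u.2.1 - u.2.2.2,
          (u.1 + u.2.1, u.2.2.1 + u.2.2.2))) =
          (sumPair S X).bind fun a => (sumPair T Y).bind fun b =>
            PMF.pure (a.1 - b.1, a.2 - b.2, (a.1, b.1)) := by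
        simp only [hP, joint, sumPair, PMF.map_bind, PMF.pure_map, PMF.bind_bind, PMF.pure_bind]
      rw [hl, hκ, hμ]
      simp only [joint, subLaw, PMF.map_bind, PMF.pure_map, PMF.bind_bind, PMF.pure_bind]
      congr 1
      funext z
      rw [PMF.bind_comm]
    · rintro ⟨a, b⟩ ⟨c, d⟩ h
      simp only [Prod.mk.injEq] at h
      simp [h.2.1, h.2.2]
  rw [e1, e2, e3, e4] at h
  have h5 : avg (addLaw S X) (fun z => avg (addLaw T Y) fun w => ruzsaDist (κ z) (μ w)) =
      avg (addLaw S X) (fun z => avg (addLaw T Y) fun w => entropy (subLaw (κ z) (μ w))) +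
        (-1 / 2 * avg (addLaw S X) (fun z => entropy (κ z)) +
          -1 / 2 * avg (addLaw T Y) (fun w => entropy (μ w))) := by
    rw [← avg_const hZ (-1 / 2 * avg (addLaw T Y) _), ← avg_const_mul, ← avg_add hZ, ← avg_add hZ]
    refine avg_congr fun z _ => ?_
    rw [← avg_const hW (-1 / 2 * entropy (κ z)), ← avg_const_mul, ← avg_add hW, ← avg_add hW]
    exact avg_congr fun w _ => by rw [ruzsaDist]; ring
  rw [h5, ruzsaDist, ruzsaDist, ruzsaDist]
  linarith

/-! ### Sums of copies of a minimizing pair -/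

/-- Adding independent copies of a minimizing pair to `(S, T)` raises the Ruzsa distance by at most
a small multiple of the entropy increments. -/
lemma IsMinimizer.ruzsaDist_addLaw_le {A : Finset G} {hA : A.Nonempty} {K : ℝ}
    (hXY : IsMinimizer A hA K X Y) (hS : S.support.Finite) (hT : T.support.Finite)
    (hδ : 0 ≤ η / (log₂ (16 * K) * log₃ (16 * K))) :
    ruzsaDist (addLaw S X) (addLaw T Y) ≤ ruzsaDist S T +
      η / (log₂ (16 * K) * log₃ (16 * K)) / 2 *
        (entropy (addLaw S X) - entropy S + (entropy (addLaw T Y) - entropy T)) := by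
  have hX := A.finite_toSet.subset hXY.support_left
  have hY := A.finite_toSet.subset hXY.support_right
  set δ := η / (log₂ (16 * K) * log₃ (16 * K)) with hδdef
  set U := PMF.uniformOfFinset A hA with hUdef
  have hU : U.support.Finite := A.finite_toSet.subset (by rw [PMF.support_uniformOfFinset])
  have hZ := finite_support_addLaw hS hX
  have hW := finite_support_addLaw hT hY
  obtain ⟨κ, hκ, hκs⟩ := exists_joint_eq (sumPair S X)
  obtain ⟨μ, hμ, hμs⟩ := exists_joint_eq (sumPair T Y)
  rw [map_fst_sumPair] at hκ hμ
  rw [map_snd_sumPair] at hκs hμs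
  have hκf := fun a => hX.subset (hκs a)
  have hμf := fun a => hY.subset (hμs a)
  have h1 := ruzsaDist_addLaw_add_avg_le hS hX hT hY hκ hμ hκf hμf
  have h2 := avg_ruzsaDist_le hS hX hU hκ hκf
  have h3 := avg_ruzsaDist_le hT hY hU hμ hμf
  have h4 : ∀ z w, ruzsaDist X Y + δ * (ruzsaDist X U + ruzsaDist Y U) ≤
      ruzsaDist (κ z) (μ w) + δ * (ruzsaDist (κ z) U + ruzsaDist (μ w) U) := fun z w =>
    hXY.le (κ z) (μ w) ((hκs z).trans hXY.support_left) ((hμs w).trans hXY.support_right)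
  have h5 := avg_mono hZ fun z _ => avg_mono hW fun w _ => h4 z w
  simp only [avg_const hZ, avg_const hW, avg_add hZ, avg_add hW, avg_const_mul] at h5
  have h6 := mul_le_mul_of_nonneg_left h2 hδ
  have h7 := mul_le_mul_of_nonneg_left h3 hδ
  linarith

/-- Adding one copy at a time makes the entropy increments telescope. -/
lemma IsMinimizer.ruzsaDist_iidSum_le {A : Finset G} {hA : A.Nonempty} {K : ℝ}
    (hXY : IsMinimizer A hA K X Y) (hδ : 0 ≤ η / (log₂ (16 * K) * log₃ (16 * K))) (n : ℕ) :
    ruzsaDist (iidSum X (n + 1)) (iidSum Y (n + 1)) ≤ ruzsaDist X Y +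
      η / (log₂ (16 * K) * log₃ (16 * K)) / 2 *
        (entropy (iidSum X (n + 1)) - entropy X + (entropy (iidSum Y (n + 1)) - entropy Y)) := by
  have hX := A.finite_toSet.subset hXY.support_left
  have hY := A.finite_toSet.subset hXY.support_right
  induction n with
  | zero => simp [iidSum_one]
  | succ n ih =>
    have h := hXY.ruzsaDist_addLaw_le (finite_support_iidSum hX (n + 1))
      (finite_support_iidSum hY (n + 1)) hδ
    change ruzsaDist (addLaw (iidSum X (n + 1)) X) (addLaw (iidSum Y (n + 1)) Y) ≤ _ + _ *
      (entropy (addLaw (iidSum X (n + 1)) X) - _ + (entropy (addLaw (iidSum Y (n + 1)) Y) - _))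
    linarith

lemma entropy_iidSum_mono (hX : X.support.Finite) : Monotone fun n => entropy (iidSum X n) :=
  monotone_nat_of_le_succ fun n => entropy_le_entropy_addLaw (finite_support_iidSum hX n) hX

lemma entropy_iidSum_two_pow_le (hX : X.support.Finite) (hY : Y.support.Finite) {D : ℝ} (J : ℕ)
    (hD : ∀ j < J, ruzsaDist (iidSum X (2 ^ j)) (iidSum Y (2 ^ j)) ≤ D) :
    entropy (iidSum X (2 ^ J)) ≤ entropy X + 2 * J * D := by
  induction J with
  | zero => simp [iidSum_one]
  | succ J ih =>
    have h1 := ih fun j hj => hD j (by omega)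
    have h2 := entropy_addLaw_self_le (finite_support_iidSum hX (2 ^ J))
      (finite_support_iidSum hY (2 ^ J))
    have h3 := hD J (by omega)
    rw [pow_succ, mul_two, iidSum_add]
    push_cast
    linarith

/-- Sums of few copies of a minimizing pair stay within twice its Ruzsa distance. -/
lemma IsMinimizer.ruzsaDist_iidSum_le_two_mul {A : Finset G} {hA : A.Nonempty} {K : ℝ}
    (hXY : IsMinimizer A hA K X Y) (hδ : 0 ≤ η / (log₂ (16 * K) * log₃ (16 * K))) (n : ℕ)
    (hn : 1 ≤ n) (hn' : 4 * (η / (log₂ (16 * K) * log₃ (16 * K))) * Nat.clog 2 n ≤ 1) :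
    ruzsaDist (iidSum X n) (iidSum Y n) ≤ 2 * ruzsaDist X Y := by
  have hX := A.finite_toSet.subset hXY.support_left
  have hY := A.finite_toSet.subset hXY.support_right
  induction n using Nat.strong_induction_on with
  | _ n ih =>
    have hD : ∀ j < Nat.clog 2 n,
        ruzsaDist (iidSum X (2 ^ j)) (iidSum Y (2 ^ j)) ≤ 2 * ruzsaDist X Y := by
      intro j hj
      -- Doubling up to `2 ^ clog 2 n ≥ n` uses distances only at strictly smaller powers, where the
      -- induction hypothesis applies.
      have hlt : 2 ^ j < n := (Nat.lt_clog_iff_pow_lt (by norm_num)).1 hj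
      refine ih _ hlt Nat.one_le_two_pow (le_trans ?_ hn')
      have : (Nat.clog 2 (2 ^ j) : ℝ) ≤ Nat.clog 2 n := by
        exact_mod_cast Nat.clog_mono_right 2 hlt.le
      gcongr
    have hpow : n ≤ 2 ^ Nat.clog 2 n := Nat.le_pow_clog (by norm_num) n
    have h1 := (entropy_iidSum_mono hX hpow).trans (entropy_iidSum_two_pow_le hX hY _ hD)
    have h2 := (entropy_iidSum_mono hY hpow).trans
      (entropy_iidSum_two_pow_le hY hX (D := 2 * ruzsaDist X Y) _ fun j hj => by
        rw [ruzsaDist_comm (finite_support_iidSum hY _) (finite_support_iidSum hX _)]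
        exact hD j hj)
    have h3 := hXY.ruzsaDist_iidSum_le hδ (n - 1)
    rw [Nat.sub_add_cancel hn] at h3
    have h0 := ruzsaDist_nonneg hX hY
    set δ := η / (log₂ (16 * K) * log₃ (16 * K))
    -- Each increment is at most `4 * clog 2 n * d[X;Y]`; two of them times `δ / 2` give the factor
    -- `4 * δ * clog 2 n` of `hn'`.
    have h4 := mul_le_mul_of_nonneg_left (add_le_add h1 h2) hδ
    have h5 := mul_le_mul_of_nonneg_right hn' h0
    linarith

end Group

/-! ### Numerical estimates and conclusion -/

lemma one_le_log₂_sixteen_mul {n : ℕ} (hn : 2 ≤ n) : 1 ≤ log₂ (16 * n) := by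
  have hn' : (2 : ℝ) ≤ n := by exact_mod_cast hn
  have h1 : Real.log (2 ^ 5) ≤ Real.log (16 * n) :=
    Real.log_le_log (by norm_num) (by linarith)
  rw [Real.log_pow] at h1
  have h2 := Real.log_two_gt_d9
  push_cast at h1
  rw [log₂, Real.le_log_iff_exp_le (by linarith)]
  have := Real.exp_one_lt_d9
  linarith

/-- The threshold on `K` forces `log₃ (16K) ≥ 1`, so the denominator of `δ` dominates `log₂ (16K)`.
-/
lemma clog_le_of_le_log_pow {K : ℝ} (hK : Real.exp (Real.exp (Real.exp 1)) ≤ K) {n : ℕ}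
    (hn : 2 ≤ n) (hnK : (n : ℝ) ≤ Real.log K ^ 6) :
    0 ≤ η / (log₂ (16 * K) * log₃ (16 * K)) ∧
      4 * (η / (log₂ (16 * K) * log₃ (16 * K))) * Nat.clog 2 n ≤ 1 := by
  have hK0 : 0 < K := (Real.exp_pos _).trans_le hK
  have a1 : Real.exp (Real.exp 1) ≤ Real.log K := (Real.le_log_iff_exp_le hK0).2 hK
  have a0 : 0 < Real.log K := (Real.exp_pos _).trans_le a1
  have a2 : Real.log K ≤ Real.log (16 * K) := Real.log_le_log hK0 (by linarith)
  have a3 : Real.exp 1 ≤ log₂ (16 * K) :=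
    (Real.le_log_iff_exp_le (a0.trans_le a2)).2 (a1.trans a2)
  have a4 : 0 < log₂ (16 * K) := (Real.exp_pos _).trans_le a3
  have a5 : 1 ≤ log₃ (16 * K) := (Real.le_log_iff_exp_le a4).2 a3
  have a6 : 1 ≤ log₂ (16 * K) := by linarith [Real.add_one_le_exp 1]
  have a7 : Real.log (Real.log K) ≤ log₂ (16 * K) := Real.log_le_log a0 a2
  have hδ : 0 ≤ η / (log₂ (16 * K) * log₃ (16 * K)) := by
    unfold η; positivity
  refine ⟨hδ, ?_⟩
  have b1 : 2 ^ (Nat.clog 2 n - 1) < n := by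
    simpa using Nat.pow_pred_clog_lt_self (b := 2) (by norm_num) (by omega : 1 < n)
  have b2 : ((Nat.clog 2 n - 1 : ℕ) : ℝ) * Real.log 2 ≤ 6 * Real.log (Real.log K) := by
    have : ((2 : ℝ) ^ (Nat.clog 2 n - 1)) ≤ Real.log K ^ 6 := by
      refine le_trans ?_ hnK
      exact_mod_cast b1.le
    have := Real.log_le_log (by positivity) this
    rw [Real.log_pow, Real.log_pow] at this
    exact_mod_cast this
  have b3 : (Nat.clog 2 n : ℝ) ≤ ((Nat.clog 2 n - 1 : ℕ) : ℝ) + 1 := by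
    exact_mod_cast (by omega : Nat.clog 2 n ≤ Nat.clog 2 n - 1 + 1)
  -- Since `6 / log 2 + 1 < 13`, with room to spare; then `4 * 13 ≤ 1009` suffices.
  have b4 : (Nat.clog 2 n : ℝ) ≤ 13 * log₂ (16 * K) := by
    have := Real.log_two_gt_d9
    have : (0 : ℝ) ≤ ((Nat.clog 2 n - 1 : ℕ) : ℝ) := by positivity
    nlinarith
  have b5 : (Nat.clog 2 n : ℝ) ≤ 13 * (log₂ (16 * K) * log₃ (16 * K)) := by
    nlinarith
  have hpos : 0 < log₂ (16 * K) * log₃ (16 * K) := by positivity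
  rw [η, mul_div_assoc', div_mul_eq_mul_div, div_le_one hpos]
  linarith

end EntropicRuzsa

end

theorem proposition3p1 :
    ∃ C : ℝ, ∀ (G : Type*) [AddCommGroup G] [DecidableEq G]
      (A : Finset G) (hA : A.Nonempty) (K : ℝ),
      ((A + A).card : ℝ) ≤ K * (A.card : ℝ) →
      ∀ X Y : PMF G, EntropicRuzsa.IsMinimizer A hA K X Y →
      ∀ k : ℝ, 0 < k → Real.log k = EntropicRuzsa.ruzsaDist X Y →
        K ≤ C ∨
        ∀ n : ℕ, 2 ≤ n → (n : ℝ) ≤ (Real.log K) ^ 6 →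
          EntropicRuzsa.ruzsaDist (EntropicRuzsa.iidSum X n) (EntropicRuzsa.iidSum Y n)
            ≤ Real.log k + Real.log k * EntropicRuzsa.log₂ (16 * (n : ℝ)) := by
  refine ⟨Real.exp (Real.exp (Real.exp 1)), ?_⟩
  intro G _ _ A hA K _ X Y hXY k _ hk
  refine or_iff_not_imp_left.2 fun hK n hn hnK => ?_
  obtain ⟨hδ, hclog⟩ := EntropicRuzsa.clog_le_of_le_log_pow (not_le.1 hK).le hn hnK
  have h := hXY.ruzsaDist_iidSum_le_two_mul hδ n (by omega) hclog
  have h0 : 0 ≤ EntropicRuzsa.ruzsaDist X Y := EntropicRuzsa.ruzsaDist_nonneg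
    (A.finite_toSet.subset hXY.support_left) (A.finite_toSet.subset hXY.support_right)
  have h1 := mul_le_mul_of_nonneg_left (EntropicRuzsa.one_le_log₂_sixteen_mul hn) h0
  rw [hk]
  linarith
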